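/- **Corollary 9.7.** Cardinals are identified with initial ordinals. For a set $A$ and a cardinal $\tau$ put $P_\tau(A)=[A]^{<\tau}=\{a\subseteq A:|a|<\tau\}$. Let $\kappa$ be a regular infinite cardinal, $\lambda\ge\kappa$ a cardinal, $\theta$ a cardinal with $2\le\theta\le\kappa$, and $\delta$ an ordinal with $\kappa\le\delta\le\lambda$. Let $\overline\theta=\nu$ if $\theta=\kappa=\nu^+$, and $\overline\theta=\theta$ otherwise. For a cardinal $\mu\ge\kappa$, let $I_{\kappa,\mu}$ be the collection of all $B\subseteq P_\kappa(\mu)$ for which there is $a\in P_\kappa(\mu)$ such that $a\not\subseteq b$ for all $b\in B$. An *ideal* on $P_\kappa(\mu)$ is a collection $K\supseteq I_{\kappa,\mu}$ of subsets of $P_\kappa(\mu)$, closed under subsets and under unions of fewer than $\kappa$ (and at least one) of its members, with $P_\kappa(\mu)\notin K$. Its cofinality $\mathrm{cof}(K)$ is the least cardinality of an $S\subseteq K$ such that $K=\bigcup_{B\in S}P(B)$, where $P(B)$ is the power set of $B$. For an ordinal $1\le\eta\le\mu$, a cardinal $2\le\chi\le\kappa$ and an ideal $J$ on $P_\kappa(\mu)$,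 let $\nabla^{[\eta]^{<\chi}}J$ be the collection of all $B\subseteq P_\kappa(\mu)$ for which there are $B_e\in J$ $(e\in P_\chi(\eta))$ such that every $a\in B$ with $a\cap\chi\ne\emptyset$ belongs to $B_e$ for some $e\in P_\chi(\eta)\cap P_{|a\cap\chi|}(a\cap\eta)$. The ideal $J$ is *$[\eta]^{<\chi}$-normal* if $J=\nabla^{[\eta]^{<\chi}}J$. If there is an $[\eta]^{<\theta}$-normal ideal on $P_\kappa(\mu)$, put $NS_{\kappa,\mu}^{[\eta]^{<\theta}}=\nabla^{[\eta]^{<\overline\theta\cdot 3}}I_{\kappa,\mu}$ (this is the least such ideal). Finally, for cardinals $\rho$, $\sigma\ge 2$ and $\nu\ge\sigma\cdot\aleph_0$, $\mathrm{cov}(\rho,\nu,\nu,\sigma)$ is the least cardinality of an $X\subseteq P_\nu(\rho)$ such that for every $c\in P_\nu(\rho)$ there is $d\in P_\sigma(X)$ with $c\subseteq\bigcup d$. Assume that there exists a $[\delta]^{<\theta}$-normal ideal on $P_\kappa(\lambda)$. Then there exists a $[|\delta|]^{<\theta}$-normal ideal on $P_\kappa(|\delta|)$, and $$\mathrm{cof}\big(NS_{\kappa,\lambda}^{[\delta]^{<\theta}}\big)=\mathrm{cof}\big(NS_{\kappa,|\delta|}^{[|\delta|]^{<\theta}}\big)\cdot\mathrm{cov}\big(\lambda,(|\delta|^{<\overline\theta})^+,(|\delta|^{<\overline\theta})^+,2\big),$$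 where $|\delta|^{<\overline\theta}=\sup\{|\delta|^{\rho}:\rho<\overline\theta \text{ a cardinal}\}$. -/

import Mathlib

universe u v

namespace PkLambda

open Cardinal Order

noncomputable section

/-- `P_τ(A) = [A]^{<τ}`: the subsets of `A` of cardinality less than `τ`. -/
def Psub {α : Type v} (τ : Cardinal.{v}) (A : Set α) : Set (Set α) :=
  {a | a ⊆ A ∧ #a < τ}

/-- `P_κ(lam)`. The cardinal `lam` is identified with the set of ordinals below it. -/
def Pkl (κ lam : Cardinal.{u}) : Set (Set Ordinal.{u}) :=
  Psub (lift.{u + 1} κ) (Set.Iio lam.ord)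

/-- `P_θ(δ)` for an ordinal `δ`, identified with the set of ordinals below it. -/
def Pord (θ : Cardinal.{u}) (δ : Ordinal.{u}) : Set (Set Ordinal.{u}) :=
  Psub (lift.{u + 1} θ) (Set.Iio δ)

/-- `I_{κ,lam}`: the `B ⊆ P_κ(lam)` such that, for some `a ∈ P_κ(lam)`, no `b ∈ B` contains `a`. -/
def Ikl (κ lam : Cardinal.{u}) : Set (Set (Set Ordinal.{u})) :=
  {B | B ⊆ Pkl κ lam ∧ ∃ a ∈ Pkl κ lam, ∀ b ∈ B, ¬ a ⊆ b}

/-- `K` is an ideal on `P_κ(lam)`: a `cf(κ)`-complete proper ideal containing `I_{κ,lam}`. -/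
structure IsIdeal (κ lam : Cardinal.{u}) (K : Set (Set (Set Ordinal.{u}))) : Prop where
  subset_space : ∀ B ∈ K, B ⊆ Pkl κ lam
  downward : ∀ B ∈ K, ∀ C ⊆ B, C ∈ K
  complete : ∀ Y ⊆ K, Y.Nonempty → #Y < lift.{u + 1} κ.ord.cof → ⋃₀ Y ∈ K
  bounded_mem : Ikl κ lam ⊆ K
  proper : Pkl κ lam ∉ K

/-- The diagonal union of the family `X`: all `a` in `P_κ(lam)` such that
`a ∈ X e` for some `e ∈ P_θ(δ)` with `e ∈ P_{|a ∩ θ|}(a ∩ δ)`. -/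
def diagUnion (κ lam : Cardinal.{u}) (δ : Ordinal.{u}) (θ : Cardinal.{u})
    (X : Set Ordinal.{u} → Set (Set Ordinal.{u})) : Set (Set Ordinal.{u}) :=
  {a | a ∈ Pkl κ lam ∧ ∃ e ∈ Pord θ δ, a ∈ X e ∧
    e ∈ Psub #(a ∩ Set.Iio θ.ord : Set Ordinal.{u}) (a ∩ Set.Iio δ)}

/-- `∇^{[δ]^{<θ}} J`. -/
def nabla (κ lam : Cardinal.{u}) (δ : Ordinal.{u}) (θ : Cardinal.{u})
    (J : Set (Set (Set Ordinal.{u}))) : Set (Set (Set Ordinal.{u})) :=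
  {B | B ⊆ Pkl κ lam ∧ ∃ X : Set Ordinal.{u} → Set (Set Ordinal.{u}),
    (∀ e ∈ Pord θ δ, X e ∈ J) ∧
    B ⊆ {a | a ∈ Pkl κ lam ∧ a ∩ Set.Iio θ.ord = ∅} ∪ diagUnion κ lam δ θ X}

/-- `J` is a `[δ]^{<θ}`-normal ideal on `P_κ(lam)`. -/
structure IsNormalIdeal (κ lam : Cardinal.{u}) (δ : Ordinal.{u}) (θ : Cardinal.{u})
    (J : Set (Set (Set Ordinal.{u}))) : Prop where
  isIdeal : IsIdeal κ lam J
  normal : J = nabla κ lam δ θ J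

open Classical in
/-- For `θ ≤ κ`: the cardinal `ν` if `θ = κ = ν⁺`, and `θ` otherwise. -/
def thetaBar (κ θ : Cardinal.{u}) : Cardinal.{u} :=
  if h : θ = κ ∧ ∃ ν, κ = succ ν then h.2.choose else θ

/-- `NS_{κ,lam}^{[δ]^{<θ}}`, meaningful when a `[δ]^{<θ}`-normal ideal on `P_κ(lam)` exists
(it is then the least one). -/
def NS (κ lam : Cardinal.{u}) (δ : Ordinal.{u}) (θ : Cardinal.{u}) :
    Set (Set (Set Ordinal.{u})) :=
  nabla κ lam δ (thetaBar κ θ * 3) (Ikl κ lam)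

/-- `cof(K)`: the least cardinality of an `S ⊆ K` such that `K` is the union of
the power sets of the members of `S`. -/
def cofIdeal {α : Type v} (K : Set (Set α)) : Cardinal.{v} :=
  sInf {μ | ∃ S ⊆ K, #S = μ ∧ K = ⋃ B ∈ S, 𝒫 B}

/-- `cov(ρ, ν, τ, σ)`: the least cardinality of an `X ⊆ P_ν(ρ)` such that every
`c ∈ P_τ(ρ)` is covered by the union of some `d ∈ P_σ(X)`. -/
def cov (ρ ν τ σ : Cardinal.{u}) : Cardinal.{u + 1} :=
  sInf {μ | ∃ X ⊆ Pord ν ρ.ord, #X = μ ∧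
    ∀ c ∈ Pord τ ρ.ord, ∃ d ∈ Psub (lift.{u + 1} σ) X, c ⊆ ⋃₀ d}

end

end PkLambda

namespace PkLambda

open Cardinal Order Set

/-! ### Cofinalities of preorders -/

/-! Write `π = |δ|`, `τ = thetaBar κ θ * 3` and `μ = π ^< thetaBar κ θ`. A set lies in `NS` exactly
when, for some `f : P_τ(δ) → P_κ(lam)`, none of its members is closed under `f`
(`mem_nabla_Ikl_iff`). Since `f`-closed sets can be found above any given set, `cof(NS)` is the
dominating number of these functions under pointwise inclusion (`Admissible.cofIdeal_NS`). The same
holds on `P_κ(π)`, and both index sets `P_τ(δ)` and `P_τ(π)` have size `μ`. As `cov(lam, μ⁺, μ⁺, 2)`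
is the cofinality of `P_{μ⁺}(lam)`, it remains to show, for `|ι| = μ`, that `cof(ι → P_κ(lam)) =
cof(ι → P_κ(π)) * cof(P_{μ⁺}(lam))`.

For `≥`, each factor is Tukey below the left side, which is infinite and so equals its square. For
`≤` (`Admissible.cof_fun_le`), cover the union of the values of `f` by some `c` of size at most `μ`,
code the points of `c` by elements of `P_τ(π)`, dominate the coded function inside `P_κ(π)`, and
decode. Decoding stays below `κ` because a set of size `< κ` has fewer than `κ` subsets of size `<
τ` (`Admissible.mk_Psub_lt`), a consequence of the existence of a normal ideal. That existence
passes to `P_κ(π)` by projection. -/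

theorem cof_le_cof_of_tukey {α β : Type v} [Preorder α] [Preorder β] (φ : α → β) (ψ : β → α)
    (h : ∀ a b, φ a ≤ b → a ≤ ψ b) : cof α ≤ cof β := by
  obtain ⟨s, hs, hs'⟩ := exists_cof_eq β
  rw [← hs']
  refine (cof_le (s := ψ '' s) fun a => ?_).trans mk_image_le
  obtain ⟨b, hb, hab⟩ := hs (φ a)
  exact ⟨ψ b, mem_image_of_mem _ hb, h _ _ hab⟩

/-- A two-stage Tukey reduction: the second query `φ' a b` may depend on the answer `b` to the
first. -/
theorem cof_le_cof_mul_cof {α β γ : Type v} [Preorder α] [Preorder β] [Preorder γ]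
    (φ : α → β) (φ' : α → β → γ) (ψ : β → γ → α)
    (h : ∀ a b c, φ a ≤ b → φ' a b ≤ c → a ≤ ψ b c) : cof α ≤ cof β * cof γ := by
  obtain ⟨s, hs, hs'⟩ := exists_cof_eq β
  obtain ⟨t, ht, ht'⟩ := exists_cof_eq γ
  rw [← hs', ← ht', mul_def]
  refine (cof_le (s := range fun p : s × t => ψ p.1 p.2) fun a => ?_).trans mk_range_le
  obtain ⟨b, hb, hab⟩ := hs (φ a)
  obtain ⟨c, hc, hac⟩ := ht (φ' a b)
  exact ⟨ψ b c, ⟨(⟨b, hb⟩, ⟨c, hc⟩), rfl⟩, h _ _ _ hab hac⟩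

theorem aleph0_le_cof_of_isDirectedOrder {α : Type v} [Preorder α] [Nonempty α]
    [IsDirectedOrder α] [NoTopOrder α] : ℵ₀ ≤ cof α := by
  rw [le_cof_iff]
  intro s hs
  by_contra! h
  have hfin : s.Finite := by rwa [Set.Finite, ← mk_lt_aleph0_iff]
  obtain ⟨m, hm⟩ := hfin.bddAbove
  obtain ⟨x, hx⟩ := exists_not_le m
  obtain ⟨y, hy, hxy⟩ := hs x
  exact hx (hxy.trans (hm hy))

/-- The cofinality of a downward closed family is its cofinality under inclusion. -/
theorem cofIdeal_eq_cof {α : Type v} {K : Set (Set α)} (hK : ∀ B ∈ K, ∀ C ⊆ B, C ∈ K) :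
    cofIdeal K = cof K := by
  apply le_antisymm
  · obtain ⟨s, hs, hs'⟩ := exists_cof_eq K
    refine csInf_le' ⟨Subtype.val '' s, by simp, ?_, ?_⟩
    · rw [← hs', mk_image_eq Subtype.val_injective]
    · ext B
      simp only [mem_iUnion, mem_powerset_iff]
      constructor
      · intro hB
        obtain ⟨C, hC, hBC⟩ := hs ⟨B, hB⟩
        exact ⟨C, mem_image_of_mem _ hC, hBC⟩
      · rintro ⟨_, ⟨C, hC, rfl⟩, hBC⟩
        exact hK _ C.2 _ hBC
  · refine le_csInf ⟨_, K, subset_rfl, rfl, ?_⟩ ?_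
    · ext B
      simp only [mem_iUnion, mem_powerset_iff]
      exact ⟨fun hB => ⟨B, hB, subset_rfl⟩, fun ⟨C, hC, hBC⟩ => hK _ hC _ hBC⟩
    · rintro _ ⟨S, hSK, rfl, hS⟩
      refine (cof_le (s := Subtype.val ⁻¹' S) fun B => ?_).trans
        (mk_preimage_of_injective _ _ Subtype.val_injective)
      have hB := hS.subset B.2
      simp only [mem_iUnion, mem_powerset_iff] at hB
      obtain ⟨C, hC, hBC⟩ := hB
      exact ⟨⟨C, hSK hC⟩, hC, hBC⟩

/-- `cov(ρ, ν, ν, 2)` is the cofinality of `P_ν(ρ)` under inclusion. -/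
theorem cov_eq_cof {ρ ν : Cardinal.{u}} (hρ : ρ ≠ 0) (hν : 1 < ν) :
    cov ρ ν ν 2 = cof (Pord ν ρ.ord) := by
  have h2 : (2 : Cardinal.{u + 1}) = succ 1 := by
    simpa [one_add_one_eq_two] using (succ_natCast.{u + 1} 1).symm
  have hlift : (lift.{u + 1} (2 : Cardinal.{u})) = 2 := by simp
  have hone : (1 : Cardinal.{u + 1}) < 2 := by norm_num
  apply le_antisymm
  · obtain ⟨s, hs, hs'⟩ := exists_cof_eq (Pord ν ρ.ord)
    refine csInf_le' ⟨Subtype.val '' s, by simp, ?_, fun c hc => ?_⟩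
    · rw [← hs', mk_image_eq Subtype.val_injective]
    · obtain ⟨x, hx, hcx⟩ := hs ⟨c, hc⟩
      refine ⟨{x.1}, ⟨by simpa using hx, ?_⟩, ?_⟩
      · rw [mk_singleton, hlift]; exact hone
      · rw [sUnion_singleton]; exact hcx
  · refine le_csInf ⟨_, Pord ν ρ.ord, subset_rfl, rfl,
      fun c hc => ⟨{c}, ⟨by simpa using hc, ?_⟩, ?_⟩⟩ ?_
    · rw [mk_singleton, hlift]; exact hone
    · simp
    · rintro _ ⟨X, hX, rfl, hcov⟩
      -- A `d` of size less than 2 may be empty, so a single covering set is only obtained for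
      -- nonempty `c`; the empty `c` is handled through `{0}`, which needs `ρ ≠ 0`.
      have key : ∀ c ∈ Pord ν ρ.ord, c.Nonempty → ∃ x ∈ X, c ⊆ x := by
        rintro c hc ⟨y, hy⟩
        obtain ⟨d, ⟨hdX, hd⟩, hcd⟩ := hcov c hc
        rw [hlift, h2, lt_succ_iff, mk_le_one_iff_set_subsingleton] at hd
        obtain ⟨x, hx, -⟩ := hcd hy
        refine ⟨x, hdX hx, fun z hz => ?_⟩
        obtain ⟨x', hx', hz'⟩ := hcd hz
        rwa [hd hx hx']
      refine (cof_le (s := Subtype.val ⁻¹' X) fun c => ?_).trans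
        (mk_preimage_of_injective _ _ Subtype.val_injective)
      rcases c.1.eq_empty_or_nonempty with h0 | hne
      · obtain ⟨x, hx, -⟩ := key {0} ⟨by simpa [pos_iff_ne_zero] using hρ, by simpa using hν⟩ (by simp)
        refine ⟨⟨x, hX hx⟩, hx, ?_⟩
        change c.1 ⊆ x
        simp [h0]
      · obtain ⟨x, hx, hcx⟩ := key c.1 c.2 hne
        exact ⟨⟨x, hX hx⟩, hx, hcx⟩

/-! ### Cardinal arithmetic -/

theorem mk_Iio_ord (ρ : Cardinal.{u}) : #(Iio ρ.ord) = lift.{u + 1} ρ := by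
  rw [mk_Iio_ordinal, card_ord]

/-- `|P_τ(δ)| = |δ|^{<τ}`. -/
theorem mk_Pord {δ : Ordinal.{u}} {τ : Cardinal.{u}} (hδ : ℵ₀ ≤ δ.card) (h1 : 1 < τ)
    (hτ : τ ≤ δ.card) : #(Pord τ δ) = lift.{u + 1} (δ.card ^< τ) := by
  have hinf : ℵ₀ ≤ #(Iio δ) := by rwa [mk_Iio_ordinal, aleph0_le_lift]
  have hle : δ.card ≤ δ.card ^< τ := by simpa using le_powerlt δ.card h1
  apply le_antisymm
  · have hsub : Pord τ δ ⊆ ⋃ o : Iio τ.ord,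
        {t : Set Ordinal.{u} | t ⊆ Iio δ ∧ #t ≤ lift.{u + 1} o.1.card} := by
      rintro t ⟨ht, htτ⟩
      obtain ⟨ρ, hρ, hρτ⟩ := lt_lift_iff.1 htτ
      exact mem_iUnion.2 ⟨⟨ρ.ord, ord_lt_ord.2 hρ⟩, ht, by simp [← hρτ]⟩
    refine (mk_le_mk_of_subset hsub).trans ((mk_iUnion_le _).trans ?_)
    have hinf' : ℵ₀ ≤ lift.{u + 1} (δ.card ^< τ) := by
      rw [aleph0_le_lift]; exact hδ.trans hle
    refine (mul_le_mul' (b := lift.{u + 1} (δ.card ^< τ)) (d := lift.{u + 1} (δ.card ^< τ)) ?_ ?_).trans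
      (mul_eq_self hinf').le
    · rw [mk_Iio_ord, lift_le]; exact hτ.trans hle
    · refine ciSup_le' fun o => ?_
      refine (mk_bounded_subset_le (α := Ordinal.{u}) (Iio δ) (lift.{u + 1} o.1.card)).trans ?_
      rw [max_eq_left hinf, mk_Iio_ordinal, ← lift_power, lift_le]
      exact le_powerlt _ (lt_ord.1 o.2)
  · by_contra! h
    obtain ⟨c, hc, hc'⟩ := lt_lift_iff.1 h
    refine hc.not_ge (powerlt_le.2 fun ρ hρ => ?_)
    rw [← lift_le.{u + 1}, hc', lift_power, ← mk_Iio_ord ρ, ← mk_Iio_ordinal, power_def]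
    -- A function from `ρ` to `δ` is coded by its graph, moved into `δ` by a pairing injection.
    have hj : #(Iio ρ.ord × Iio δ) ≤ #(Iio δ) := by
      rw [← mul_def, mk_Iio_ord, mk_Iio_ordinal, ← lift_mul, lift_le]
      exact (mul_le_mul' (hρ.le.trans hτ) le_rfl).trans (mul_eq_self hδ).le
    obtain ⟨j⟩ := hj
    refine mk_le_of_injective (f := fun f : Iio ρ.ord → Iio δ =>
      (⟨range fun i => ((j (i, f i) : Iio δ) : Ordinal), ?_, ?_⟩ : Pord τ δ)) ?_
    · rintro _ ⟨i, rfl⟩; exact (j (i, f i)).2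
    · refine mk_range_le.trans_lt ?_
      rw [mk_Iio_ord, lift_lt]; exact hρ
    · intro f g hfg
      have hfg' := congrArg Subtype.val hfg
      funext i
      have : ((j (i, f i) : Iio δ) : Ordinal) ∈ range fun i => ((j (i, g i) : Iio δ) : Ordinal) := by
        exact hfg'.subset ⟨i, rfl⟩
      obtain ⟨i', hi'⟩ := this
      have := j.injective (Subtype.ext hi')
      rw [Prod.mk.injEq] at this
      obtain ⟨rfl, h⟩ := this
      exact h.symm

theorem thetaBar_succ {ν : Cardinal.{u}} : thetaBar (succ ν) (succ ν) = ν := by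
  have h : succ ν = succ ν ∧ ∃ ν', succ ν = succ ν' := ⟨rfl, ν, rfl⟩
  rw [thetaBar, dif_pos h]
  exact (succ_injective h.2.choose_spec).symm

theorem thetaBar_of_not {κ θ : Cardinal.{u}} (h : ¬ (θ = κ ∧ ∃ ν, κ = succ ν)) :
    thetaBar κ θ = θ := by
  rw [thetaBar, dif_neg h]

theorem aleph0_le_of_succ {ν : Cardinal.{u}} (h : ℵ₀ ≤ succ ν) : ℵ₀ ≤ ν := by
  by_contra! hν
  exact (isSuccLimit_aleph0.succ_lt hν).not_ge h

theorem mul_three_of_aleph0_le {ν : Cardinal.{u}} (h : ℵ₀ ≤ ν) : ν * 3 = ν :=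
  mul_eq_left h ((ofNat_lt_aleph0.le).trans h) (by norm_num)

theorem two_le_thetaBar {κ θ : Cardinal.{u}} (hκ : ℵ₀ ≤ κ) (hθ : 2 ≤ θ) : 2 ≤ thetaBar κ θ := by
  by_cases h : θ = κ ∧ ∃ ν, κ = succ ν
  · obtain ⟨rfl, ν, rfl⟩ := h
    rw [thetaBar_succ]
    exact (ofNat_lt_aleph0.le).trans (aleph0_le_of_succ hκ)
  · rwa [thetaBar_of_not h]

theorem aleph0_le_thetaBar {κ θ : Cardinal.{u}} (hθ : ℵ₀ ≤ θ) : ℵ₀ ≤ thetaBar κ θ := by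
  by_cases h : θ = κ ∧ ∃ ν, κ = succ ν
  · obtain ⟨rfl, ν, rfl⟩ := h
    rw [thetaBar_succ]
    exact aleph0_le_of_succ hθ
  · rwa [thetaBar_of_not h]

theorem thetaBar_le {κ θ : Cardinal.{u}} : thetaBar κ θ ≤ θ := by
  by_cases h : θ = κ ∧ ∃ ν, κ = succ ν
  · obtain ⟨rfl, ν, rfl⟩ := h
    rw [thetaBar_succ]
    exact le_succ ν
  · rw [thetaBar_of_not h]

theorem thetaBar_mul_three_le {κ θ : Cardinal.{u}} (hθ : ℵ₀ ≤ θ) : thetaBar κ θ * 3 ≤ θ := by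
  rw [mul_three_of_aleph0_le (aleph0_le_thetaBar hθ)]
  exact thetaBar_le

theorem thetaBar_mul_three_lt_aleph0 {κ θ : Cardinal.{u}} (hθ : θ < ℵ₀) :
    thetaBar κ θ * 3 < ℵ₀ :=
  mul_lt_aleph0 (thetaBar_le.trans_lt hθ) ofNat_lt_aleph0

theorem thetaBar_mul_three_le_of_le {κ θ : Cardinal.{u}} (hκ : ℵ₀ ≤ κ) (hθκ : θ ≤ κ) :
    thetaBar κ θ * 3 ≤ κ := by
  rcases lt_or_ge θ ℵ₀ with hθ | hθ
  · exact (thetaBar_mul_three_lt_aleph0 hθ).le.trans hκ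
  · exact (thetaBar_mul_three_le hθ).trans hθκ

theorem one_lt_thetaBar_mul_three {κ θ : Cardinal.{u}} (hκ : ℵ₀ ≤ κ) (hθ : 2 ≤ θ) :
    1 < thetaBar κ θ * 3 := by
  have h2 : (1 : Cardinal.{u}) < 2 := by norm_num
  exact h2.trans_le ((two_le_thetaBar hκ hθ).trans (le_mul_right (by norm_num)))

/-- This is what `thetaBar` is designed for: for infinite `θ`, `succ ρ = κ` would force `θ = κ =
ρ⁺`, hence `thetaBar κ θ = ρ`, contradicting the bound on `ρ`. -/
theorem succ_lt_of_lt_thetaBar_mul_three {κ θ ρ : Cardinal.{u}} (hκ : ℵ₀ ≤ κ) (hθκ : θ ≤ κ)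
    (hρ : ρ < thetaBar κ θ * 3) : succ ρ < κ := by
  rcases lt_or_ge θ ℵ₀ with hθ | hθ
  · exact (isSuccLimit_aleph0.succ_lt (hρ.trans (thetaBar_mul_three_lt_aleph0 hθ))).trans_le hκ
  · rw [mul_three_of_aleph0_le (aleph0_le_thetaBar hθ)] at hρ
    refine lt_of_le_of_ne ((succ_le_of_lt hρ).trans (thetaBar_le.trans hθκ)) ?_
    rintro rfl
    have hθ' : θ = succ ρ := hθκ.antisymm ((succ_le_of_lt hρ).trans thetaBar_le)
    rw [hθ', thetaBar_succ] at hρ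
    exact hρ.false

theorem powerlt_thetaBar_mul_three {κ θ π : Cardinal.{u}} (hκ : ℵ₀ ≤ κ) (hθ : 2 ≤ θ)
    (hπ : ℵ₀ ≤ π) : π ^< (thetaBar κ θ * 3) = π ^< thetaBar κ θ := by
  rcases lt_or_ge θ ℵ₀ with hθ' | hθ'
  · have h1 : (1 : Cardinal.{u}) < 2 := by norm_num
    refine le_antisymm (powerlt_le.2 fun ρ hρ => ?_)
      (powerlt_le_powerlt_left (le_mul_right (by norm_num)))
    obtain ⟨n, rfl⟩ := lt_aleph0.1 (hρ.trans (thetaBar_mul_three_lt_aleph0 hθ'))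
    rw [power_natCast]
    refine (power_nat_le hπ).trans ?_
    simpa using le_powerlt π (h1.trans_le (two_le_thetaBar hκ hθ))
  · rw [mul_three_of_aleph0_le (aleph0_le_thetaBar hθ')]

/-! ### Existence of closed sets -/

/-- For each `e`, the sets omitting part of `f e` form a bounded family. If no closed set contained
`b`, their diagonal union, in `J` by normality, together with the sets not containing `b`, would be
the whole space. -/
theorem IsNormalIdeal.exists_closed {κ lam θ τ : Cardinal.{u}} {δ : Ordinal.{u}}
    {J : Set (Set (Set Ordinal.{u}))} (hκ : κ.IsRegular) (hJ : IsNormalIdeal κ lam δ θ J)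
    (hτ : τ ≤ θ) (f : Pord τ δ → Pkl κ lam) {b : Set Ordinal.{u}} (hb : b ∈ Pkl κ lam) :
    ∃ a ∈ Pkl κ lam, b ⊆ a ∧
      ∀ e : Pord τ δ, e.1 ⊆ a → #e.1 < #(a ∩ Iio τ.ord : Set Ordinal.{u}) → (f e).1 ⊆ a := by
  by_contra! H
  let X : Set Ordinal.{u} → Set (Set Ordinal.{u}) := fun e =>
    {a | a ∈ Pkl κ lam ∧ ∃ h : e ∈ Pord τ δ, ¬ (f ⟨e, h⟩).1 ⊆ a}
  let B₀ : Set (Set Ordinal.{u}) := {a | a ∈ Pkl κ lam ∧ ¬ b ⊆ a}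
  have hX : ∀ e, X e ∈ J := by
    intro e
    refine hJ.isIdeal.bounded_mem ⟨fun a ha => ha.1, ?_⟩
    by_cases h : e ∈ Pord τ δ
    · exact ⟨(f ⟨e, h⟩).1, (f ⟨e, h⟩).2, fun a ha => ha.2.2⟩
    · exact ⟨b, hb, fun a ha => (h ha.2.1).elim⟩
  have hB₀ : B₀ ∈ J := hJ.isIdeal.bounded_mem ⟨fun a ha => ha.1, b, hb, fun a ha => ha.2⟩
  have hB₁ : diagUnion κ lam δ θ X ∈ J := by
    rw [hJ.normal]
    exact ⟨fun a ha => ha.1, X, fun e _ => hX e, subset_union_right⟩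
  have hU : B₀ ∪ diagUnion κ lam δ θ X ∈ J := by
    rw [← sUnion_pair]
    refine hJ.isIdeal.complete _ (pair_subset hB₀ hB₁) (by simp) ?_
    rw [hκ.cof_ord]
    refine lt_of_lt_of_le ?_ (aleph0_le_lift.2 hκ.aleph0_le)
    rw [lt_aleph0_iff_set_finite]
    exact toFinite _
  refine hJ.isIdeal.proper (hJ.isIdeal.downward _ hU _ fun a ha => ?_)
  by_cases hba : b ⊆ a
  · obtain ⟨e, hea, hcard, hfe⟩ := H a ha hba
    have hord : Iio τ.ord ⊆ Iio θ.ord := Iio_subset_Iio (ord_le_ord.2 hτ)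
    refine Or.inr ⟨ha, e.1, ⟨e.2.1, e.2.2.trans_le (lift_le.2 hτ)⟩, ⟨ha, e.2, hfe⟩,
      subset_inter hea e.2.1, hcard.trans_le ?_⟩
    exact mk_le_mk_of_subset (inter_subset_inter_right _ hord)
  · exact Or.inl ⟨ha, hba⟩

/-- If `κ = ℵ₀`, a finite set closed under `{n} ↦ {n + 1}` would have a largest natural number.
Starting from `{0, 1}` gives it two elements below `θ`, so singletons are admitted as indices. -/
theorem IsNormalIdeal.aleph0_lt {κ lam θ : Cardinal.{u}} {δ : Ordinal.{u}}
    {J : Set (Set (Set Ordinal.{u}))} (hκ : κ.IsRegular) (hlam : κ ≤ lam) (hθ : 2 ≤ θ)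
    (hθκ : θ ≤ κ) (hδκ : κ.ord ≤ δ) (hJ : IsNormalIdeal κ lam δ θ J) : ℵ₀ < κ := by
  refine lt_of_le_of_ne hκ.aleph0_le ?_
  rintro rfl
  rw [ord_aleph0] at hδκ
  have hωlam : Ordinal.omega0 ≤ lam.ord := by rw [← ord_aleph0]; exact ord_le_ord.2 hlam
  have hθ1 : 1 < θ := lt_of_lt_of_le (by norm_num) hθ
  have h1θ : (1 : Ordinal.{u}) < θ.ord := by
    rw [lt_ord, Ordinal.card_one]; exact hθ1
  have h0θ : (0 : Ordinal.{u}) < θ.ord := zero_lt_one.trans h1θ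
  let f : Pord θ δ → Pkl ℵ₀ lam := fun e =>
    ⟨succ '' (e.1 ∩ Iio Ordinal.omega0), by
      rintro _ ⟨y, hy, rfl⟩
      exact (Ordinal.isSuccLimit_omega0.succ_lt hy.2).trans_le hωlam,
      (mk_image_le.trans (mk_le_mk_of_subset inter_subset_left)).trans_lt
        (e.2.2.trans_le (lift_le.2 hθκ))⟩
  have hb : ({0, 1} : Set Ordinal.{u}) ∈ Pkl ℵ₀ lam := by
    refine ⟨?_, ?_⟩
    · rintro x (rfl | rfl)
      · exact Ordinal.omega0_pos.trans_le hωlam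
      · exact Ordinal.one_lt_omega0.trans_le hωlam
    · rw [lift_aleph0, lt_aleph0_iff_set_finite]
      exact toFinite _
  obtain ⟨a, ha, hba, hcl⟩ := hJ.exists_closed hκ le_rfl f hb
  have hfin : (a ∩ Iio Ordinal.omega0).Finite := by
    have := ha.2
    rw [lift_aleph0, lt_aleph0_iff_set_finite] at this
    exact this.subset inter_subset_left
  have hne : (a ∩ Iio Ordinal.omega0).Nonempty := ⟨0, hba (by simp), Ordinal.omega0_pos⟩
  obtain ⟨n, hn, hmax⟩ := hfin.exists_maximal hne
  have hen : ({n} : Set Ordinal.{u}) ∈ Pord θ δ := by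
    refine ⟨?_, ?_⟩
    · rintro _ rfl
      exact lt_of_lt_of_le hn.2 hδκ
    · rw [mk_singleton]
      simpa using hθ1
  have hcard : #({n} : Set Ordinal.{u}) < #(a ∩ Iio θ.ord : Set Ordinal.{u}) := by
    rw [mk_singleton, one_lt_iff_nontrivial, Set.nontrivial_coe_sort]
    exact ⟨0, ⟨hba (by simp), h0θ⟩, 1, ⟨hba (by simp), h1θ⟩, zero_ne_one⟩
  have hs := hcl ⟨{n}, hen⟩ (singleton_subset_iff.2 hn.1) hcard
    (mem_image_of_mem succ (⟨rfl, hn.2⟩ : n ∈ ({n} : Set Ordinal.{u}) ∩ Iio Ordinal.omega0))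
  exact (hmax ⟨hs, Ordinal.isSuccLimit_omega0.succ_lt hn.2⟩ (le_succ n)).not_gt (lt_succ n)

theorem mk_Psub_lt_of_lt_aleph0 {α : Type v} {τ κ : Cardinal.{v}} (hκ : ℵ₀ < κ) (hτ : τ < ℵ₀)
    {A : Set α} (hA : #A < κ) : #(Psub τ A) < κ := by
  refine lt_of_le_of_lt ((mk_le_mk_of_subset (t := {t : Set α | t ⊆ A ∧ #t ≤ τ})
    fun t ht => ⟨ht.1, ht.2.le⟩).trans (mk_bounded_subset_le A τ)) ?_
  obtain ⟨n, rfl⟩ := lt_aleph0.1 hτ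
  rw [power_natCast]
  exact (power_nat_le (le_max_right _ _)).trans_lt (max_lt hA hκ)

/-- For finite `θ`, `thetaBar κ θ * 3` exceeds `θ`, so normality does not apply directly. Instead
the closure is iterated `ω` times, which stays below the regular uncountable `κ`; a finite `e`
already appears at some stage. -/
theorem exists_closed_of_lt_aleph0 {κ lam τ : Cardinal.{u}} {δ : Ordinal.{u}}
    (hκ : κ.IsRegular) (hκ' : ℵ₀ < κ) (hτ : τ < ℵ₀)
    (f : Pord τ δ → Pkl κ lam) {b : Set Ordinal.{u}} (hb : b ∈ Pkl κ lam) :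
    ∃ a ∈ Pkl κ lam, b ⊆ a ∧ ∀ e : Pord τ δ, e.1 ⊆ a → (f e).1 ⊆ a := by
  have hκl : (lift.{u + 1} κ).IsRegular := hκ.lift
  have hκl' : ℵ₀ < lift.{u + 1} κ := by rwa [aleph0_lt_lift]
  have hτl : lift.{u + 1} τ < ℵ₀ := by rwa [lift_lt_aleph0]
  let next : Set Ordinal.{u} → Set Ordinal.{u} := fun c =>
    c ∪ ⋃ e : {e : Pord τ δ // e.1 ⊆ c}, (f e.1).1
  have hnext : ∀ c ∈ Pkl κ lam, next c ∈ Pkl κ lam := by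
    rintro c ⟨hc, hcκ⟩
    refine ⟨union_subset hc (iUnion_subset fun e => (f e.1).2.1), ?_⟩
    refine (mk_union_le _ _).trans_lt (add_lt_of_lt hκl.aleph0_le hcκ ?_)
    refine (card_iUnion_lt_iff_forall_of_isRegular hκl ?_).2 fun e => (f e.1).2.2
    refine lt_of_le_of_lt ?_ (mk_Psub_lt_of_lt_aleph0 hκl' hτl hcκ)
    refine mk_le_of_injective (f := fun e => ⟨e.1.1, e.2, e.1.2.2⟩) ?_
    intro e e' h
    simpa [Subtype.ext_iff] using h
  let c : ℕ → Set Ordinal.{u} := fun n => next^[n] b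
  have hcs : ∀ n, c (n + 1) = next (c n) := fun n => Function.iterate_succ_apply' _ _ _
  have hc : ∀ n, c n ∈ Pkl κ lam := by
    intro n
    induction n with
    | zero => exact hb
    | succ n ih => rw [hcs]; exact hnext _ ih
  have hmono : Monotone c := monotone_nat_of_le_succ fun n => by
    rw [hcs]; exact subset_union_left
  refine ⟨⋃ n, c n, ⟨iUnion_subset fun n => (hc n).1, ?_⟩, subset_iUnion c 0, fun e he => ?_⟩
  · have : (⋃ n, c n) = ⋃ n : ULift.{u + 1} ℕ, c n.down :=
      (Equiv.ulift.surjective.iUnion_comp c).symm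
    rw [this]
    exact (card_iUnion_lt_iff_forall_of_isRegular hκl (by simpa using hκl')).2 fun n => (hc n.down).2
  · have hfin : e.1.Finite := by
      rw [← lt_aleph0_iff_set_finite]
      exact e.2.2.trans hτl
    obtain ⟨n, hn⟩ := hmono.directed_le.exists_mem_subset_of_finset_subset_biUnion
      (s := hfin.toFinset) (by simpa using he)
    have hen : e.1 ⊆ c n := by simpa using hn
    refine subset_trans ?_ (subset_iUnion c (n + 1))
    rw [hcs]
    exact (subset_iUnion (fun e : {e : Pord τ δ // e.1 ⊆ c n} => (f e.1).1) ⟨e, hen⟩).trans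
      subset_union_right

/-- The standing assumptions on the parameters. -/
structure Admissible (κ lam θ : Cardinal.{u}) (δ : Ordinal.{u}) : Prop where
  regular : κ.IsRegular
  le_lam : κ ≤ lam
  two_le : 2 ≤ θ
  theta_le : θ ≤ κ
  ord_le : κ.ord ≤ δ
  le_ord : δ ≤ lam.ord
  exists_normal : ∃ J, IsNormalIdeal κ lam δ θ J

namespace Admissible

variable {κ lam θ : Cardinal.{u}} {δ : Ordinal.{u}}

theorem exists_closed (H : Admissible κ lam θ δ)
    (f : Pord (thetaBar κ θ * 3) δ → Pkl κ lam) {b : Set Ordinal.{u}}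
    (hb : b ∈ Pkl κ lam) :
    ∃ a ∈ Pkl κ lam, b ⊆ a ∧ ∀ e : Pord (thetaBar κ θ * 3) δ, e.1 ⊆ a →
      #e.1 < #(a ∩ Iio (thetaBar κ θ * 3).ord : Set Ordinal.{u}) → (f e).1 ⊆ a := by
  obtain ⟨J, hJ⟩ := H.exists_normal
  rcases lt_or_ge θ ℵ₀ with hθ | hθ
  · obtain ⟨a, ha, hba, h⟩ := exists_closed_of_lt_aleph0 H.regular
      (hJ.aleph0_lt H.regular H.le_lam H.two_le H.theta_le H.ord_le)
      (thetaBar_mul_three_lt_aleph0 hθ) f hb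
    exact ⟨a, ha, hba, fun e he _ => h e he⟩
  · exact hJ.exists_closed H.regular (thetaBar_mul_three_le hθ) f hb

/-- Every `c ∈ P_κ(lam)` extends to some `b ∈ P_κ(lam)` such that any `a ⊇ b` has more elements
below `τ = thetaBar κ θ * 3` than any subset of `c` of size less than `τ`. -/
theorem exists_wide (H : Admissible κ lam θ δ) {c : Set Ordinal.{u}} (hc : c ∈ Pkl κ lam) :
    ∃ b ∈ Pkl κ lam, c ⊆ b ∧ ∀ a, b ⊆ a → ∀ e ⊆ c, #e < lift.{u + 1} (thetaBar κ θ * 3) →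
      #e < #(a ∩ Iio (thetaBar κ θ * 3).ord : Set Ordinal.{u}) := by
  have hκ := H.regular.aleph0_le
  obtain ⟨ρ, hρκ, hρ⟩ := lt_lift_iff.1 hc.2
  set τ := thetaBar κ θ * 3
  -- Adjoining all ordinals below `min τ ρ⁺`, with `ρ = |c|`, makes the set wide enough.
  have hm : min τ (succ ρ) < κ := by
    rcases lt_or_ge ρ τ with h | h
    · exact (min_le_right _ _).trans_lt (succ_lt_of_lt_thetaBar_mul_three hκ H.theta_le h)
    · exact (min_le_left _ _).trans_lt (h.trans_lt hρκ)
  refine ⟨c ∪ Iio (min τ (succ ρ)).ord, ⟨union_subset hc.1 ?_, ?_⟩, subset_union_left, ?_⟩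
  · exact Iio_subset_Iio (ord_le_ord.2 (hm.le.trans H.le_lam))
  · refine (mk_union_le _ _).trans_lt (add_lt_of_lt (aleph0_le_lift.2 hκ) hc.2 ?_)
    rw [mk_Iio_ord, lift_lt]
    exact hm
  · intro a hba e hec heτ
    have h1 : Iio (min τ (succ ρ)).ord ⊆ a ∩ Iio τ.ord :=
      subset_inter (subset_union_right.trans hba) (Iio_subset_Iio (ord_le_ord.2 (min_le_left _ _)))
    refine lt_of_lt_of_le ?_ (mk_le_mk_of_subset h1)
    have heρ : #e ≤ lift.{u + 1} ρ := by rw [hρ]; exact mk_le_mk_of_subset hec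
    obtain ⟨ε, hε, hεe⟩ := lt_lift_iff.1 heτ
    rw [← hεe, lift_le] at heρ
    rw [mk_Iio_ord, ← hεe, lift_lt]
    exact lt_min hε (lt_succ_iff.2 heρ)

/-- Otherwise `κ` injects by `j` into these subsets of `c`. A sufficiently wide set containing `c`
and closed under `j y ↦ {y}` would contain all of `κ`, yet have size `< κ`. -/
theorem mk_Psub_lt (H : Admissible κ lam θ δ) {c : Set Ordinal.{u}}
    (hcδ : c ⊆ Iio δ) (hc : #c < lift.{u + 1} κ) :
    #(Psub (lift.{u + 1} (thetaBar κ θ * 3)) c) < lift.{u + 1} κ := by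
  by_contra! h
  rw [← mk_Iio_ord κ] at h
  obtain ⟨j⟩ := h
  obtain ⟨b, hb, hcb, hwide⟩ := H.exists_wide ⟨hcδ.trans (Iio_subset_Iio H.le_ord), hc⟩
  have h1κ : 1 < lift.{u + 1} κ := one_lt_aleph0.trans_le (aleph0_le_lift.2 H.regular.aleph0_le)
  let f : Pord (thetaBar κ θ * 3) δ → Pkl κ lam := fun e =>
    ⟨{x | ∃ y : Iio κ.ord, y.1 = x ∧ (j y).1 = e.1}, by
      rintro _ ⟨y, rfl, -⟩
      exact lt_of_lt_of_le y.2 (ord_le_ord.2 H.le_lam), by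
      refine lt_of_le_of_lt (mk_le_one_iff_set_subsingleton.2 ?_) h1κ
      rintro _ ⟨y, rfl, hy⟩ _ ⟨z, rfl, hz⟩
      rw [j.injective (Subtype.ext (hy.trans hz.symm))]⟩
  obtain ⟨a, ha, hba, hcl⟩ := H.exists_closed f hb
  have hκa : Iio κ.ord ⊆ a := by
    intro x hx
    have hjx := (j ⟨x, hx⟩).2
    exact hcl ⟨(j ⟨x, hx⟩).1, hjx.1.trans hcδ, hjx.2⟩ (hjx.1.trans (hcb.trans hba))
      (hwide a hba _ hjx.1 hjx.2) ⟨⟨x, hx⟩, rfl, rfl⟩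
  have := (mk_le_mk_of_subset hκa).trans_lt ha.2
  rw [mk_Iio_ord] at this
  exact this.false

end Admissible

/-! ### The ideal `NS` through functions -/

/-- The members of `P_κ(lam)` that are not closed under `f`. -/
def nonClosed {κ lam τ : Cardinal.{u}} {δ : Ordinal.{u}} (f : Pord τ δ → Pkl κ lam) :
    Set (Set Ordinal.{u}) :=
  {a | a ∈ Pkl κ lam ∧ (a ∩ Iio τ.ord = ∅ ∨ ∃ e : Pord τ δ, e.1 ⊆ a ∧
    #e.1 < #(a ∩ Iio τ.ord : Set Ordinal.{u}) ∧ ¬ (f e).1 ⊆ a)}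

theorem nonClosed_mono {κ lam τ : Cardinal.{u}} {δ : Ordinal.{u}} {f g : Pord τ δ → Pkl κ lam}
    (h : f ≤ g) : nonClosed f ⊆ nonClosed g := by
  rintro a ⟨ha, h0 | ⟨e, hea, hcard, hfe⟩⟩
  · exact ⟨ha, Or.inl h0⟩
  · exact ⟨ha, Or.inr ⟨e, hea, hcard, fun hg => hfe (subset_trans (h e) hg)⟩⟩

theorem mem_nabla_Ikl_iff {κ lam τ : Cardinal.{u}} {δ : Ordinal.{u}}
    {B : Set (Set Ordinal.{u})} :
    B ∈ nabla κ lam δ τ (Ikl κ lam) ↔ ∃ f : Pord τ δ → Pkl κ lam, B ⊆ nonClosed f := by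
  constructor
  · rintro ⟨-, X, hX, hBX⟩
    choose! g hg hgX using fun e he => (hX e he).2
    refine ⟨fun e => ⟨g e.1, hg e.1 e.2⟩, fun a ha => ?_⟩
    rcases hBX ha with ⟨ha', h0⟩ | ⟨ha', e, he, hae, hea, hcard⟩
    · exact ⟨ha', Or.inl h0⟩
    · exact ⟨ha', Or.inr ⟨⟨e, he⟩, hea.trans inter_subset_left, hcard, hgX e he a hae⟩⟩
  · rintro ⟨f, hf⟩
    refine ⟨fun a ha => (hf ha).1,
      fun e => {a | a ∈ Pkl κ lam ∧ ∃ h : e ∈ Pord τ δ, ¬ (f ⟨e, h⟩).1 ⊆ a}, fun e he => ?_,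
      fun a ha => ?_⟩
    · exact ⟨fun a ha => ha.1, (f ⟨e, he⟩).1, (f ⟨e, he⟩).2, fun a ha => ha.2.2⟩
    · obtain ⟨ha', h0 | ⟨e, hea, hcard, hfe⟩⟩ := hf ha
      · exact Or.inl ⟨ha', h0⟩
      · exact Or.inr ⟨ha', e.1, e.2, ⟨ha', e.2, hfe⟩, subset_inter hea e.2.1, hcard⟩

/-- `cof(NS)` is the dominating number of the functions from `P_τ(δ)` to `P_κ(lam)`,
where `τ = thetaBar κ θ * 3`. -/
theorem Admissible.cofIdeal_NS {κ lam θ : Cardinal.{u}} {δ : Ordinal.{u}}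
    (H : Admissible κ lam θ δ) :
    cofIdeal (NS κ lam δ θ) = cof (Pord (thetaBar κ θ * 3) δ → Pkl κ lam) := by
  have hmem : ∀ {B}, B ∈ NS κ lam δ θ ↔
      ∃ f : Pord (thetaBar κ θ * 3) δ → Pkl κ lam, B ⊆ nonClosed f := mem_nabla_Ikl_iff
  rw [cofIdeal_eq_cof fun B hB C hCB => ?_]
  · apply le_antisymm
    · choose φ hφ using fun B : NS κ lam δ θ => hmem.1 B.2
      exact cof_le_cof_of_tukey φ (fun f => ⟨nonClosed f, hmem.2 ⟨f, subset_rfl⟩⟩)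
        fun B f h => (hφ B).trans (nonClosed_mono h)
    -- From `B` read off the function choosing for each `e` a set `a ∉ B` for which `e` is an
    -- admitted index. If `nonClosed f ⊆ B`, then `a` is closed under `f`, so `f e ⊆ a`.
    · have key : ∀ (B : NS κ lam δ θ) (e : Pord (thetaBar κ θ * 3) δ), ∃ a : Pkl κ lam,
          a.1 ∉ B.1 ∧ e.1 ⊆ a ∧ #e.1 < #(a.1 ∩ Iio (thetaBar κ θ * 3).ord : Set Ordinal.{u}) := by
        intro B e
        obtain ⟨f, hf⟩ := hmem.1 B.2
        have hκ := H.regular.aleph0_le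
        obtain ⟨b, hb, heb, hwide⟩ := H.exists_wide (c := e.1)
          ⟨e.2.1.trans (Iio_subset_Iio H.le_ord),
            e.2.2.trans_le (lift_le.2 (thetaBar_mul_three_le_of_le hκ H.theta_le))⟩
        obtain ⟨a, ha, hba, hcl⟩ := H.exists_closed f hb
        have hcard := hwide a hba e.1 subset_rfl e.2.2
        refine ⟨⟨a, ha⟩, fun haB => ?_, heb.trans hba, hcard⟩
        obtain ⟨-, h0 | ⟨e', hea, hcard', hfe⟩⟩ := hf haB
        · simp [h0] at hcard
        · exact hfe (hcl e' hea hcard')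
      choose ψ hψ hψe hψc using key
      refine cof_le_cof_of_tukey (fun f => ⟨nonClosed f, hmem.2 ⟨f, subset_rfl⟩⟩) ψ
        fun f B hfB e => ?_
      by_contra hfe
      exact hψ B e (hfB ⟨(ψ B e).2, Or.inr ⟨e, hψe B e, hψc B e, hfe⟩⟩)
  · obtain ⟨f, hf⟩ := hmem.1 hB
    exact hmem.2 ⟨f, hCB.trans hf⟩

/-! ### Projection of normal ideals -/

/-- The image of a normal ideal on `P_κ(lam)` under `a ↦ a ∩ π` is a normal ideal on `P_κ(π)`. -/
theorem IsNormalIdeal.project {κ lam θ π : Cardinal.{u}} {δ : Ordinal.{u}}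
    {J : Set (Set (Set Ordinal.{u}))} (hπδ : π.ord ≤ δ) (hδ : δ ≤ lam.ord) (hθπ : θ ≤ π)
    (hJ : IsNormalIdeal κ lam δ θ J) :
    IsNormalIdeal κ π π.ord θ
      {B | B ⊆ Pkl κ π ∧ {a | a ∈ Pkl κ lam ∧ a ∩ Iio π.ord ∈ B} ∈ J} := by
  have hord : Iio π.ord ⊆ Iio lam.ord := Iio_subset_Iio (hπδ.trans hδ)
  have htr : ∀ a ∈ Pkl κ lam, a ∩ Iio π.ord ∈ Pkl κ π := fun a ha =>
    ⟨inter_subset_right, (mk_le_mk_of_subset inter_subset_left).trans_lt ha.2⟩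
  have hid : IsIdeal κ π
      {B | B ⊆ Pkl κ π ∧ {a | a ∈ Pkl κ lam ∧ a ∩ Iio π.ord ∈ B} ∈ J} := by
    refine ⟨fun B hB => hB.1, fun B hB C hCB => ⟨hCB.trans hB.1, ?_⟩, fun Y hY hne hcard => ?_,
      fun B hB => ⟨hB.1, ?_⟩, fun h => ?_⟩
    · exact hJ.isIdeal.downward _ hB.2 _ fun a ha => ⟨ha.1, hCB ha.2⟩
    · refine ⟨sUnion_subset fun B hB => (hY hB).1, ?_⟩
      have := hJ.isIdeal.complete
        ((fun B : Set (Set Ordinal.{u}) => {a | a ∈ Pkl κ lam ∧ a ∩ Iio π.ord ∈ B}) '' Y) ?_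
        (hne.image _) (mk_image_le.trans_lt hcard)
      · refine hJ.isIdeal.downward _ this _ ?_
        rintro a ⟨ha, B, hB, haB⟩
        exact ⟨_, mem_image_of_mem _ hB, ha, haB⟩
      · rintro _ ⟨B, hB, rfl⟩
        exact (hY hB).2
    · obtain ⟨-, b, hb, hbB⟩ := hB
      refine hJ.isIdeal.bounded_mem ⟨fun a ha => ha.1, b, ⟨hb.1.trans hord, hb.2⟩, ?_⟩
      exact fun a ha hba => hbB _ ha.2 (subset_inter hba hb.1)
    · exact hJ.isIdeal.proper (hJ.isIdeal.downward _ h.2 _ fun a ha => ⟨ha, htr a ha⟩)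
  -- One inclusion takes the constant family `B` with index `∅`, which is admitted as soon as `a`
  -- meets `θ`.
  refine ⟨hid, Subset.antisymm (fun B hB => ⟨hB.1, fun _ => B, fun _ _ => hB, fun a ha => ?_⟩) ?_⟩
  · rcases (a ∩ Iio θ.ord).eq_empty_or_nonempty with h0 | hne
    · exact Or.inl ⟨hB.1 ha, h0⟩
    · have hpos : 0 < #(a ∩ Iio θ.ord : Set Ordinal.{u}) := by
        rw [pos_iff_ne_zero, mk_ne_zero_iff]
        exact hne.to_subtype
      have hθ0 : 0 < lift.{u + 1} θ := by
        refine hpos.trans_le ?_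
        rw [← mk_Iio_ord]
        exact mk_le_mk_of_subset inter_subset_right
      refine Or.inr ⟨hB.1 ha, ∅, ⟨empty_subset _, ?_⟩, ha, empty_subset _, ?_⟩
      · rwa [mk_eq_zero]
      · rwa [mk_eq_zero]
  · rintro B ⟨hB, X, hX, hBX⟩
    refine ⟨hB, ?_⟩
    rw [hJ.normal]
    refine ⟨fun a ha => ha.1,
      -- Indices now range over `P_θ(δ)`; those not contained in `π` receive the empty set.
      fun e => {a | e ⊆ Iio π.ord ∧ a ∈ Pkl κ lam ∧ a ∩ Iio π.ord ∈ X e}, fun e he => ?_, ?_⟩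
    · by_cases h : e ⊆ Iio π.ord
      · exact hJ.isIdeal.downward _ (hX e ⟨h, he.2⟩).2 _ fun a ha => ha.2
      · refine hJ.isIdeal.downward _ (hX ∅ ⟨empty_subset _, ?_⟩).2 _ fun a ha => (h ha.1).elim
        rw [mk_eq_zero]
        exact zero_le.trans_lt he.2
    · rintro a ⟨ha, haB⟩
      have hθ : a ∩ Iio π.ord ∩ Iio θ.ord = a ∩ Iio θ.ord := by
        rw [inter_assoc, inter_eq_self_of_subset_right (Iio_subset_Iio (ord_le_ord.2 hθπ))]
      rcases hBX haB with ⟨-, h0⟩ | ⟨-, e, he, haX, hea, hcard⟩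
      · exact Or.inl ⟨ha, hθ ▸ h0⟩
      · rw [hθ] at hcard
        refine Or.inr ⟨ha, e, ⟨he.1.trans (Iio_subset_Iio hπδ), he.2⟩, ⟨he.1, ha, haX⟩, ?_, hcard⟩
        exact subset_inter (hea.trans (inter_subset_left.trans inter_subset_left))
          (he.1.trans (Iio_subset_Iio hπδ))

theorem Admissible.project {κ lam θ : Cardinal.{u}} {δ : Ordinal.{u}}
    (H : Admissible κ lam θ δ) : Admissible κ δ.card θ δ.card.ord := by
  have hκδ : κ ≤ δ.card := Cardinal.ord_le.1 H.ord_le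
  obtain ⟨J, hJ⟩ := H.exists_normal
  exact ⟨H.regular, hκδ, H.two_le, H.theta_le, ord_le_ord.2 hκδ, le_rfl,
    _, hJ.project (ord_card_le δ) H.le_ord (H.theta_le.trans hκδ)⟩

/-! ### Dominating numbers -/

theorem Admissible.mk_Pord_eq {κ lam θ : Cardinal.{u}} {δ : Ordinal.{u}}
    (H : Admissible κ lam θ δ) :
    #(Pord (thetaBar κ θ * 3) δ) = lift.{u + 1} (δ.card ^< thetaBar κ θ) := by
  have hκ := H.regular.aleph0_le
  have hκδ : κ ≤ δ.card := Cardinal.ord_le.1 H.ord_le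
  rw [← powerlt_thetaBar_mul_three hκ H.two_le (hκ.trans hκδ)]
  exact mk_Pord (hκ.trans hκδ) (one_lt_thetaBar_mul_three hκ H.two_le)
    ((thetaBar_mul_three_le_of_le hκ H.theta_le).trans hκδ)

theorem cof_fun_le_of_injective {ι ι' : Type (u + 1)} {κ π lam : Cardinal.{u}} (hπ : π ≤ lam)
    {j : ι → ι'} (hj : Function.Injective j) (h0 : 0 < κ) :
    cof (ι → Pkl κ π) ≤ cof (ι' → Pkl κ lam) := by
  have hord : Iio π.ord ⊆ Iio lam.ord := Iio_subset_Iio (ord_le_ord.2 hπ)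
  let inc : Pkl κ π → Pkl κ lam := fun a => ⟨a.1, a.2.1.trans hord, a.2.2⟩
  have hbot : (∅ : Set Ordinal.{u}) ∈ Pkl κ lam := ⟨empty_subset _, by simpa using h0⟩
  refine cof_le_cof_of_tukey (fun f => Function.extend j (inc ∘ f) fun _ => ⟨∅, hbot⟩)
    (fun h i => ⟨(h (j i)).1 ∩ Iio π.ord, inter_subset_right,
      (mk_le_mk_of_subset inter_subset_left).trans_lt (h (j i)).2.2⟩) fun f h hfh i => ?_
  have := hfh (j i)
  simp only [hj.extend_apply] at this
  exact subset_inter this (f i).2.1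

theorem aleph0_le_cof_fun {ι : Type (u + 1)} [Nonempty ι] {κ lam : Cardinal.{u}} (hκ : ℵ₀ ≤ κ)
    (hlam : κ ≤ lam) : ℵ₀ ≤ cof (ι → Pkl κ lam) := by
  have hκl : ℵ₀ ≤ lift.{u + 1} κ := aleph0_le_lift.2 hκ
  have hsing : ∀ x ∈ Iio lam.ord, ({x} : Set Ordinal.{u}) ∈ Pkl κ lam := fun x hx =>
    ⟨by simpa using hx, by rw [mk_singleton]; exact one_lt_aleph0.trans_le hκl⟩
  have : IsDirectedOrder (Pkl κ lam) := ⟨fun a b =>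
    ⟨⟨a.1 ∪ b.1, union_subset a.2.1 b.2.1,
      (mk_union_le _ _).trans_lt (add_lt_of_lt hκl a.2.2 b.2.2)⟩,
      subset_union_left, subset_union_right⟩⟩
  have : IsDirectedOrder (ι → Pkl κ lam) := ⟨fun f g => by
    choose h hf hg using fun i => exists_ge_ge (f i) (g i)
    exact ⟨h, hf, hg⟩⟩
  have hbot : (∅ : Set Ordinal.{u}) ∈ Pkl κ lam :=
    ⟨empty_subset _, by rw [mk_eq_zero]; exact aleph0_pos.trans_le hκl⟩
  have : Nonempty (ι → Pkl κ lam) := ⟨fun _ => ⟨∅, hbot⟩⟩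
  have : NoTopOrder (ι → Pkl κ lam) := ⟨fun f => by
    by_contra! hf
    obtain ⟨i⟩ := ‹Nonempty ι›
    have hall : Iio lam.ord ⊆ (f i).1 := fun x hx => hf (fun _ => ⟨{x}, hsing x hx⟩) i rfl
    have := (mk_le_mk_of_subset hall).trans_lt (f i).2.2
    rw [mk_Iio_ord, lift_lt] at this
    exact this.not_ge hlam⟩
  exact aleph0_le_cof_of_isDirectedOrder

theorem iUnion_Pkl_mem_Pord {ι : Type (u + 1)} {κ lam μ : Cardinal.{u}} (hκ : ℵ₀ ≤ κ) (hμ : κ ≤ μ)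
    (hι : #ι = lift.{u + 1} μ) (f : ι → Pkl κ lam) :
    (⋃ i, (f i).1) ∈ Pord (succ μ) lam.ord := by
  refine ⟨iUnion_subset fun i => (f i).2.1, ?_⟩
  rw [lift_succ, lt_succ_iff]
  refine (mk_iUnion_le _).trans ?_
  rw [hι]
  refine (mul_le_mul' le_rfl (ciSup_le' fun i => (f i).2.2.le.trans (lift_le.2 hμ))).trans ?_
  exact (mul_eq_self (aleph0_le_lift.2 (hκ.trans hμ))).le

/-- Spread `c` over `ι` by an injection, with at most one point at each index; the union of the
values of any dominating function then covers `c`. -/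
theorem cof_Pord_succ_le {ι : Type (u + 1)} {κ lam μ : Cardinal.{u}} (hκ : ℵ₀ ≤ κ) (hμ : κ ≤ μ)
    (hι : #ι = lift.{u + 1} μ) : cof (Pord (succ μ) lam.ord) ≤ cof (ι → Pkl κ lam) := by
  have hj : ∀ c : Pord (succ μ) lam.ord, Nonempty (c.1 ↪ ι) := fun c => by
    have := c.2.2
    rwa [lift_succ, lt_succ_iff, ← hι] at this
  have h1 : 1 < lift.{u + 1} κ := one_lt_aleph0.trans_le (aleph0_le_lift.2 hκ)
  refine cof_le_cof_of_tukey
    (fun c i => ⟨{x | ∃ h : x ∈ c.1, (hj c).some ⟨x, h⟩ = i}, fun x hx => c.2.1 hx.1, ?_⟩)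
    (fun f => ⟨⋃ i, (f i).1, iUnion_Pkl_mem_Pord hκ hμ hι f⟩) fun c f hcf x hx => ?_
  · refine lt_of_le_of_lt (mk_le_one_iff_set_subsingleton.2 ?_) h1
    rintro x ⟨hx, rfl⟩ y ⟨hy, hxy⟩
    exact congrArg Subtype.val ((hj c).some.injective hxy).symm
  · exact mem_iUnion.2 ⟨_, hcf ((hj c).some ⟨x, hx⟩) ⟨hx, rfl⟩⟩

/-- Coding step: with `c` covering all values of `f` and `j c` injecting `c` into `P_τ(π)`, replace
`f i` by the union of the codes of its points. If `h` dominates this, the points of `c` with code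
inside `h i` include `f i`. -/
theorem Admissible.cof_fun_le {ι : Type (u + 1)} {κ lam θ π : Cardinal.{u}}
    (H : Admissible κ π θ π.ord) (hι : #ι = lift.{u + 1} (π ^< thetaBar κ θ)) :
    cof (ι → Pkl κ lam) ≤
      cof (Pord (succ (π ^< thetaBar κ θ)) lam.ord) * cof (ι → Pkl κ π) := by
  set μ := π ^< thetaBar κ θ
  have hκ := H.regular.aleph0_le
  have hπμ : π ≤ μ := by
    have h2 : (1 : Cardinal.{u}) < 2 := by norm_num
    simpa using le_powerlt π (h2.trans_le (two_le_thetaBar hκ H.two_le))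
  have hκμ : κ ≤ μ := H.le_lam.trans hπμ
  have hj : ∀ c : Pord (succ μ) lam.ord, Nonempty (c.1 ↪ Pord (thetaBar κ θ * 3) π.ord) :=
    fun c => by
      have h := c.2.2
      have hmk := H.mk_Pord_eq
      rw [card_ord] at hmk
      rwa [lift_succ, lt_succ_iff, ← hmk] at h
  have hκl : (lift.{u + 1} κ).IsRegular := H.regular.lift
  let j : ∀ c : Pord (succ μ) lam.ord, c.1 ↪ Pord (thetaBar κ θ * 3) π.ord := fun c => (hj c).some
  refine cof_le_cof_mul_cof (fun f => ⟨⋃ i, (f i).1, iUnion_Pkl_mem_Pord hκ hκμ hι f⟩)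
    (fun f c i => ⟨⋃ y : {y : c.1 // y.1 ∈ (f i).1}, (j c y.1).1,
      iUnion_subset fun y => (j c y.1).2.1, ?_⟩)
    (fun c h i => ⟨{x | ∃ hx : x ∈ c.1, (j c ⟨x, hx⟩).1 ⊆ (h i).1}, fun x hx => c.2.1 hx.1, ?_⟩)
    fun f c h hfc hch i x hx => ?_
  · refine (card_iUnion_lt_iff_forall_of_isRegular hκl ?_).2 fun y =>
      (j c y.1).2.2.trans_le (lift_le.2 (thetaBar_mul_three_le_of_le hκ H.theta_le))
    refine lt_of_le_of_lt ?_ (f i).2.2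
    refine mk_le_of_injective (f := fun y => ⟨y.1.1, y.2⟩) fun y z hyz => ?_
    simpa [Subtype.ext_iff] using hyz
  -- The decoded set injects, through its codes, into the subsets of `h i` of size `< τ`.
  · refine lt_of_le_of_lt ?_ (H.mk_Psub_lt (h i).2.1 (h i).2.2)
    refine mk_le_of_injective (f := fun x => ⟨(j c ⟨x.1, x.2.1⟩).1, x.2.2, (j c _).2.2⟩)
      fun x y hxy => ?_
    have hxy' : (j c ⟨x.1, x.2.1⟩).1 = (j c ⟨y.1, y.2.1⟩).1 := by
      have := congrArg Subtype.val hxy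
      exact this
    have := (j c).injective (Subtype.ext hxy')
    simpa [Subtype.ext_iff] using this
  · have hxc : x ∈ c.1 := hfc (mem_iUnion.2 ⟨i, hx⟩)
    exact ⟨hxc, (subset_iUnion (fun y : {y : c.1 // y.1 ∈ (f i).1} => (j c y.1).1)
      ⟨⟨x, hxc⟩, hx⟩).trans (hch i)⟩

end PkLambda

open PkLambda

theorem corollary9p7 (κ lam θ : Cardinal.{u}) (δ : Ordinal.{u})
    (hκ : κ.IsRegular) (hlam : κ ≤ lam) (hθ : 2 ≤ θ) (hθκ : θ ≤ κ)
    (hδκ : κ.ord ≤ δ) (hδ : δ ≤ lam.ord)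
    (hex : ∃ J, PkLambda.IsNormalIdeal κ lam δ θ J) :
    (∃ J, PkLambda.IsNormalIdeal κ δ.card δ.card.ord θ J) ∧
    PkLambda.cofIdeal (PkLambda.NS κ lam δ θ) =
      PkLambda.cofIdeal (PkLambda.NS κ δ.card δ.card.ord θ) *
        PkLambda.cov lam
          (Order.succ (Cardinal.powerlt δ.card (PkLambda.thetaBar κ θ)))
          (Order.succ (Cardinal.powerlt δ.card (PkLambda.thetaBar κ θ))) 2 := by
  have H : Admissible κ lam θ δ := ⟨hκ, hlam, hθ, hθκ, hδκ, hδ, hex⟩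
  have H' := H.project
  refine ⟨H'.exists_normal, ?_⟩
  have hκδ : κ ≤ δ.card := H'.le_lam
  have hδlam : δ.card ≤ lam := by simpa using Ordinal.card_le_card hδ
  have hκ0 := hκ.aleph0_le
  have hmk := H.mk_Pord_eq
  have hmk' := H'.mk_Pord_eq
  rw [Cardinal.card_ord] at hmk'
  have h1 : (1 : Cardinal.{u}) < 2 := by norm_num
  have hδμ : δ.card ≤ δ.card.powerlt (thetaBar κ θ) := by
    simpa using Cardinal.le_powerlt δ.card (h1.trans_le (two_le_thetaBar hκ0 hθ))
  have hμ := hκδ.trans hδμ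
  have hμ1 : 1 < Order.succ (δ.card.powerlt (thetaBar κ θ)) :=
    (Cardinal.one_lt_aleph0.trans_le (hκ0.trans hμ)).trans (Order.lt_succ _)
  have hlam0 : lam ≠ 0 := (Cardinal.aleph0_pos.trans_le (hκ0.trans hlam)).ne'
  obtain ⟨j⟩ := Cardinal.eq.1 (hmk'.trans hmk.symm)
  rw [H.cofIdeal_NS, H'.cofIdeal_NS, cov_eq_cof hlam0 hμ1]
  apply le_antisymm
  · refine (H'.cof_fun_le hmk).trans ?_
    rw [mul_comm]
    exact mul_le_mul' (cof_fun_le_of_injective le_rfl j.symm.injective hκ.pos) le_rfl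
  · have hne : Nonempty (Pord (thetaBar κ θ * 3) δ) := by
      rw [← Cardinal.mk_ne_zero_iff, hmk, Ne, Cardinal.lift_eq_zero]
      exact (Cardinal.aleph0_pos.trans_le (hκ0.trans hμ)).ne'
    -- The left side is infinite, so it suffices to bound each factor by it separately.
    rw [← Cardinal.mul_eq_self (aleph0_le_cof_fun (ι := Pord (thetaBar κ θ * 3) δ) hκ0 hlam)]
    exact mul_le_mul' (cof_fun_le_of_injective hδlam j.injective hκ.pos)
      (cof_Pord_succ_le hκ0 hμ hmk)
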